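/- Let $\mathcal M_*$ be the Gromov space: the set of pointed isometry classes $[M,x]$ of pointed proper metric spaces (all closed balls compact). For metric spaces $M,N$, a metric on $M\sqcup N$ is called admissible if it restricts to the given metrics on $M$ and $N$. For $R,r>0$ let $U_{R,r}$ be the set of pairs $([M,x],[N,y])$ for which there is an admissible metric $d$ on $M\sqcup N$ with $d(x,y)<r$ and $$\max\Bigl\{\sup_{u\in B_M(x,R)}d(u,N),\ \sup_{v\in B_N(y,R)}d(v,M)\Bigr\}<r ,$$ where $B_M(x,R)$ and $B_N(y,R)$ are open balls. Give $\mathcal M_*$ the topology in which a set $O$ is open if and only if for every $P\in O$ there are $R,r>0$ with $U_{R,r}(P)\subset O$ (the topology of the uniformity with base the sets $U_{R,r}$). Let $d_{GH}(M,x;N,y)=\inf_d\max\{d(x,y),H_d(M,N)\}\in[0,\infty]$, where $d$ runs over the admissible metrics on $M\sqcup N$ and $H_d$ is the Hausdorff distance. Let $d_{\mathrm{Lip}}(M,x;N,y)\in[0,\infty]$ be the infimum of all $r\ge 0$ for which there is a bijection $\phi:M\to N$ with $\phi(x)=y$ and $e^{-r}d_M(u,v)\le d_N(\phi(u),\phi(v))\le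 e^{r}d_M(u,v)$ for all $u,v\in M$. Let $E_{GH}$ be the relation $d_{GH}<\infty$ on $\mathcal M_*$, let $E_{\mathrm{Lip}}$ be the relation given by the existence of a pointed bi-Lipschitz bijection, and let the quasi-isometry relation $E_{QI}$ be the smallest equivalence relation on $\mathcal M_*$ containing $E_{GH}\cup E_{\mathrm{Lip}}$. Finally, let $d_{QI}(P,Q)$ be the infimum of the sums $$\sum_{i=1}^k \bigl(d_{GH}(P_{2i-2},P_{2i-1})+d_{\mathrm{Lip}}(P_{2i-1},P_{2i})\bigr)$$ over all $k\ge1$ and all finite sequences $P=P_0,P_1,\dots,P_{2k}=Q$ in $\mathcal M_*$, and let $B_{QI}(P;r)=\{Q\in\mathcal M_* : d_{QI}(P,Q)<r\}$. Then every equivalence class of $E_{QI}$ is meager in $\mathcal M_*$. Moreover, for every $[M,x]\in\mathcal M_*$ and every $r>0$, the ball $B_{QI}(M,x;r)$ is nowhere dense in $\mathcal M_*$. -/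

import Mathlib

open scoped ENNReal NNReal

noncomputable section

/-- A pointed proper metric space `(M, x)`: every closed ball is compact. A proper metric space has
at most the cardinality of the continuum, so every pointed proper metric space is isometric to one
with carrier in `Type`. -/
structure PointedProperSpace : Type 1 where
  carrier : Type
  [metric : MetricSpace carrier]
  [proper : ProperSpace carrier]
  pt : carrier

namespace PointedProperSpace

attribute [instance] PointedProperSpace.metric PointedProperSpace.proper

/-- Pointed isometry: a surjective isometry carrying base point to base point. -/
instance isometrySetoid : Setoid PointedProperSpace where
  r A B := ∃ e : A.carrier ≃ᵢ B.carrier, e A.pt = B.pt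
  iseqv :=
    { refl := fun A => ⟨IsometryEquiv.refl A.carrier, rfl⟩
      symm := fun {A B} ⟨e, he⟩ => ⟨e.symm, by rw [← he, e.symm_apply_apply]⟩
      trans := fun {A B C} ⟨e, he⟩ ⟨f, hf⟩ => ⟨e.trans f, by
        rw [IsometryEquiv.trans_apply, he, hf]⟩ }

/-- A metric on `M ⊔ N` is admissible if it restricts to the given metrics on `M` and on `N`. -/
def IsAdmissible {M N : Type} [MetricSpace M] [MetricSpace N] (d : MetricSpace (M ⊕ N)) : Prop :=
  (∀ u u' : M, d.dist (Sum.inl u) (Sum.inl u') = dist u u') ∧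
    (∀ v v' : N, d.dist (Sum.inr v) (Sum.inr v') = dist v v')

/-- `H_{d,R}(M,x;N,y)` for subsets `M`, `N` of a metric space `(X, d)`: the maximum of
the suprema of `d(u,N)` over `u ∈ B_M(x,R)` and of `d(v,M)` over `v ∈ B_N(y,R)`. -/
def localHausdorff {X : Type} [MetricSpace X] (R : ℝ) (M : Set X) (x : X) (N : Set X) (y : X) :
    ℝ≥0∞ :=
  max (⨆ u ∈ M ∩ Metric.ball x R, Metric.infEDist u N)
    (⨆ v ∈ N ∩ Metric.ball y R, Metric.infEDist v M)

/-- The entourage `U_{R,r}` at the level of pointed proper metric spaces: there is an admissible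
metric `d` on `M ⊔ N` with `max {d(x,y), H_{d,R}(M,x;N,y)} < r`. -/
def Close (R r : ℝ) (A B : PointedProperSpace) : Prop :=
  ∃ d : MetricSpace (A.carrier ⊕ B.carrier), IsAdmissible d ∧
    letI := d
    max (edist (Sum.inl A.pt : A.carrier ⊕ B.carrier) (Sum.inr B.pt))
      (localHausdorff R (Set.range (Sum.inl : A.carrier → A.carrier ⊕ B.carrier)) (Sum.inl A.pt)
        (Set.range (Sum.inr : B.carrier → A.carrier ⊕ B.carrier)) (Sum.inr B.pt))
      < ENNReal.ofReal r

/-- The pointed Gromov-Hausdorff distance: the infimum over the admissible metrics `d` on `M ⊔ N`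
of `max {d(x,y), H_d(M,N)}`. -/
def ghDist (A B : PointedProperSpace) : ℝ≥0∞ :=
  ⨅ (d : MetricSpace (A.carrier ⊕ B.carrier)) (_ : IsAdmissible d),
    letI := d
    max (edist (Sum.inl A.pt : A.carrier ⊕ B.carrier) (Sum.inr B.pt))
      (Metric.hausdorffEDist (Set.range (Sum.inl : A.carrier → A.carrier ⊕ B.carrier))
        (Set.range (Sum.inr : B.carrier → A.carrier ⊕ B.carrier)))

/-- The Lipschitz distance: the infimum of the `r ≥ 0` such that some pointed bijection `φ`
satisfies `e⁻ʳ d(u,v) ≤ d(φ u, φ v) ≤ eʳ d(u,v)`; it is `∞` if there is no such `φ`. -/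
def lipDist (A B : PointedProperSpace) : ℝ≥0∞ :=
  ⨅ (r : ℝ≥0) (_ : ∃ φ : A.carrier ≃ B.carrier, φ A.pt = B.pt ∧
      ∀ u v : A.carrier, Real.exp (-(r : ℝ)) * dist u v ≤ dist (φ u) (φ v) ∧
        dist (φ u) (φ v) ≤ Real.exp r * dist u v), (r : ℝ≥0∞)

/-- Existence of a pointed bi-Lipschitz bijection. -/
def LipEquivalent (A B : PointedProperSpace) : Prop :=
  ∃ φ : A.carrier ≃ B.carrier, φ A.pt = B.pt ∧
    ∃ K K' : ℝ≥0, LipschitzWith K φ ∧ LipschitzWith K' φ.symm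

theorem exists_transport {M N M' N' : Type} [MetricSpace M] [MetricSpace N] [MetricSpace M']
    [MetricSpace N'] (e : M ≃ᵢ M') (f : N ≃ᵢ N') (d : MetricSpace (M ⊕ N))
    (hd : IsAdmissible d) :
    ∃ d' : MetricSpace (M' ⊕ N'), IsAdmissible d' ∧
      @Isometry (M ⊕ N) (M' ⊕ N') d.toPseudoMetricSpace.toPseudoEMetricSpace
        d'.toPseudoMetricSpace.toPseudoEMetricSpace (Sum.map e f) := by
  have hinj : Function.Injective (Sum.map e.symm f.symm) :=
    Sum.map_injective.2 ⟨e.symm.injective, f.symm.injective⟩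
  refine ⟨MetricSpace.induced (Sum.map e.symm f.symm) hinj d, ⟨fun u u' => ?_, fun v v' => ?_⟩, ?_⟩
  · exact (hd.1 (e.symm u) (e.symm u')).trans (e.symm.isometry.dist_eq u u')
  · exact (hd.2 (f.symm v) (f.symm v')).trans (f.symm.isometry.dist_eq v v')
  · let _ := d
    let d' := MetricSpace.induced (Sum.map e.symm f.symm) hinj d
    refine Isometry.of_dist_eq fun a b => ?_
    change dist (Sum.map e.symm f.symm (Sum.map e f a)) (Sum.map e.symm f.symm (Sum.map e f b)) = _
    have h : ∀ c, Sum.map e.symm f.symm (Sum.map e f c) = c := by rintro (c | c) <;> simp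
    rw [h, h]

theorem range_inl_map {M N M' N' : Type} (e : M → M') (f : N → N') (he : Function.Surjective e) :
    Set.range (Sum.inl : M' → M' ⊕ N') = Sum.map e f '' Set.range (Sum.inl : M → M ⊕ N) := by
  ext z
  constructor
  · rintro ⟨w, rfl⟩
    obtain ⟨u, rfl⟩ := he w
    exact ⟨_, ⟨u, rfl⟩, rfl⟩
  · rintro ⟨_, ⟨u, rfl⟩, rfl⟩
    exact ⟨e u, rfl⟩

theorem range_inr_map {M N M' N' : Type} (e : M → M') (f : N → N') (hf : Function.Surjective f) :
    Set.range (Sum.inr : N' → M' ⊕ N') = Sum.map e f '' Set.range (Sum.inr : N → M ⊕ N) := by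
  ext z
  constructor
  · rintro ⟨w, rfl⟩
    obtain ⟨u, rfl⟩ := hf w
    exact ⟨_, ⟨u, rfl⟩, rfl⟩
  · rintro ⟨_, ⟨u, rfl⟩, rfl⟩
    exact ⟨f u, rfl⟩

theorem localHausdorff_image {X Y : Type} [MetricSpace X] [MetricSpace Y] {g : X → Y}
    (hg : Isometry g) (R : ℝ) (M : Set X) (x : X) (N : Set X) (y : X) :
    localHausdorff R (g '' M) (g x) (g '' N) (g y) = localHausdorff R M x N y := by
  have h : ∀ (S : Set X) (z : X), g '' S ∩ Metric.ball (g z) R = g '' (S ∩ Metric.ball z R) := by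
    intro S z
    rw [← hg.preimage_ball, Set.image_inter_preimage]
  simp only [localHausdorff, h, iSup_image, Metric.infEDist_image hg]

theorem Close.congr {R r : ℝ} {A B A' B' : PointedProperSpace} (hA : A ≈ A') (hB : B ≈ B')
    (h : Close R r A B) : Close R r A' B' := by
  obtain ⟨e, he⟩ := hA
  obtain ⟨f, hf⟩ := hB
  obtain ⟨d, hd, hlt⟩ := h
  obtain ⟨d', hd', hi⟩ := exists_transport e f d hd
  refine ⟨d', hd', ?_⟩
  let _ := d
  let _ := d'
  have hx : (Sum.inl A'.pt : A'.carrier ⊕ B'.carrier) = Sum.map e f (Sum.inl A.pt) := by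
    simp [he]
  have hy : (Sum.inr B'.pt : A'.carrier ⊕ B'.carrier) = Sum.map e f (Sum.inr B.pt) := by
    simp [hf]
  rw [hx, hy, range_inl_map e f e.surjective, range_inr_map e f f.surjective, hi.edist_eq,
    localHausdorff_image hi]
  exact hlt

theorem ghDist_le_of_equiv {A B A' B' : PointedProperSpace} (hA : A ≈ A') (hB : B ≈ B') :
    ghDist A' B' ≤ ghDist A B := by
  obtain ⟨e, he⟩ := hA
  obtain ⟨f, hf⟩ := hB
  refine le_iInf₂ fun d hd => ?_
  obtain ⟨d', hd', hi⟩ := exists_transport e f d hd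
  refine (iInf₂_le d' hd').trans ?_
  let _ := d
  let _ := d'
  have hx : (Sum.inl A'.pt : A'.carrier ⊕ B'.carrier) = Sum.map e f (Sum.inl A.pt) := by
    simp [he]
  have hy : (Sum.inr B'.pt : A'.carrier ⊕ B'.carrier) = Sum.map e f (Sum.inr B.pt) := by
    simp [hf]
  rw [hx, hy, range_inl_map e f e.surjective, range_inr_map e f f.surjective, hi.edist_eq,
    Metric.hausdorffEDist_image hi]

theorem lipDist_le_of_equiv {A B A' B' : PointedProperSpace} (hA : A ≈ A') (hB : B ≈ B') :
    lipDist A' B' ≤ lipDist A B := by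
  obtain ⟨e, he⟩ := hA
  obtain ⟨f, hf⟩ := hB
  refine le_iInf₂ fun r hr => ?_
  obtain ⟨φ, hφ, h⟩ := hr
  refine iInf₂_le r ⟨(e.symm.toEquiv.trans φ).trans f.toEquiv, ?_, fun u v => ?_⟩
  · simp [← he, hφ, hf]
  · have := h (e.symm u) (e.symm v)
    rw [e.symm.isometry.dist_eq] at this
    simpa [f.isometry.dist_eq] using this

theorem LipEquivalent.congr {A B A' B' : PointedProperSpace} (hA : A ≈ A') (hB : B ≈ B')
    (h : LipEquivalent A B) : LipEquivalent A' B' := by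
  obtain ⟨e, he⟩ := hA
  obtain ⟨f, hf⟩ := hB
  obtain ⟨φ, hφ, K, K', hK, hK'⟩ := h
  refine ⟨(e.symm.toEquiv.trans φ).trans f.toEquiv, ?_, 1 * (K * 1), 1 * (K' * 1), ?_, ?_⟩
  · simp [← he, hφ, hf]
  · exact f.isometry.lipschitz.comp (hK.comp e.symm.isometry.lipschitz)
  · exact e.isometry.lipschitz.comp (hK'.comp f.symm.isometry.lipschitz)

end PointedProperSpace

/-- The set `M_*` of pointed isometry classes `[M, x]` of pointed proper metric spaces. -/
def GromovSpace : Type 1 := Quotient PointedProperSpace.isometrySetoid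

namespace GromovSpace

open PointedProperSpace

/-- The set `U_{R,r}` of pairs of elements of `M_*`. -/
def Entourage (R r : ℝ) : GromovSpace → GromovSpace → Prop :=
  Quotient.lift₂ (Close R r) fun _ _ _ _ hA hB =>
    propext ⟨Close.congr hA hB, Close.congr (Setoid.symm hA) (Setoid.symm hB)⟩

theorem Entourage.mono {R R' r r' : ℝ} (hR : R' ≤ R) (hr : r ≤ r') {P Q : GromovSpace}
    (h : Entourage R r P Q) : Entourage R' r' P Q := by
  induction P using Quotient.inductionOn
  induction Q using Quotient.inductionOn
  obtain ⟨d, hd, hlt⟩ := h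
  refine ⟨d, hd, lt_of_le_of_lt ?_ (hlt.trans_le (ENNReal.ofReal_le_ofReal hr))⟩
  let _ := d
  refine max_le_max le_rfl (max_le_max ?_ ?_) <;>
    exact biSup_mono fun u hu => ⟨hu.1, Metric.ball_subset_ball hR hu.2⟩

/-- The topology of the Gromov space, that of the uniformity with base the `U_{R,r}`, `R, r > 0`:
a set is open iff with each point `P` it contains some `U_{R,r}(P)`. -/
instance topology : TopologicalSpace GromovSpace where
  IsOpen O := ∀ P ∈ O, ∃ R > 0, ∃ r > 0, ∀ Q, Entourage R r P Q → Q ∈ O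
  isOpen_univ := fun _ _ => ⟨1, one_pos, 1, one_pos, fun _ _ => trivial⟩
  isOpen_inter := by
    rintro O O' hO hO' P ⟨hP, hP'⟩
    obtain ⟨R, hR, r, hr, h⟩ := hO P hP
    obtain ⟨R', hR', r', hr', h'⟩ := hO' P hP'
    exact ⟨max R R', lt_max_of_lt_left hR, min r r', lt_min hr hr', fun Q hQ =>
      ⟨h Q (hQ.mono (le_max_left _ _) (min_le_left _ _)),
        h' Q (hQ.mono (le_max_right _ _) (min_le_right _ _))⟩⟩
  isOpen_sUnion := by
    rintro 𝒪 h𝒪 P ⟨O, hO, hP⟩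
    obtain ⟨R, hR, r, hr, h⟩ := h𝒪 O hO P hP
    exact ⟨R, hR, r, hr, fun Q hQ => ⟨O, hO, h Q hQ⟩⟩

/-- The pointed Gromov-Hausdorff distance `d_GH` on `M_*`, with values in `[0,∞]`. -/
def dGH : GromovSpace → GromovSpace → ℝ≥0∞ :=
  Quotient.lift₂ ghDist fun _ _ _ _ hA hB =>
    le_antisymm (ghDist_le_of_equiv (Setoid.symm hA) (Setoid.symm hB)) (ghDist_le_of_equiv hA hB)

/-- The Lipschitz distance `d_Lip` on `M_*`, with values in `[0,∞]`. -/
def dLip : GromovSpace → GromovSpace → ℝ≥0∞ :=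
  Quotient.lift₂ lipDist fun _ _ _ _ hA hB =>
    le_antisymm (lipDist_le_of_equiv (Setoid.symm hA) (Setoid.symm hB)) (lipDist_le_of_equiv hA hB)

/-- The relation `E_GH` of being at finite Gromov-Hausdorff distance. -/
def EGH (P Q : GromovSpace) : Prop := dGH P Q < ∞

/-- The Lipschitz relation `E_Lip`: existence of a pointed bi-Lipschitz bijection. -/
def ELip : GromovSpace → GromovSpace → Prop :=
  Quotient.lift₂ LipEquivalent fun _ _ _ _ hA hB =>
    propext ⟨LipEquivalent.congr hA hB, LipEquivalent.congr (Setoid.symm hA) (Setoid.symm hB)⟩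

/-- The quasi-isometry relation `E_QI`: the smallest equivalence relation on `M_*` that contains
`E_GH ∪ E_Lip`. -/
def EQI : Setoid GromovSpace := Relation.EqvGen.setoid fun P Q => EGH P Q ∨ ELip P Q

/-- The quasi-isometric distance `d_QI(P,Q)`: the infimum of the sums
`∑_{i=1}^k d_GH(c_{2i-2}, c_{2i-1}) + d_Lip(c_{2i-1}, c_{2i})` over all `k ≥ 1` and all finite
sequences `c_0 = P, …, c_{2k} = Q` in `M_*`. This is the largest distance function on `M_*` with
values in `[0,∞]` that is at most `d_GH` and at most `d_Lip`. -/
def dQI (P Q : GromovSpace) : ℝ≥0∞ :=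
  ⨅ (k : ℕ) (_ : 1 ≤ k) (c : ℕ → GromovSpace) (_ : c 0 = P) (_ : c (2 * k) = Q),
    ∑ i ∈ Finset.range k, (dGH (c (2 * i)) (c (2 * i + 1)) + dLip (c (2 * i + 1)) (c (2 * i + 2)))

/-- The ball `B_QI(P; r)`. -/
def ballQI (P : GromovSpace) (r : ℝ) : Set GromovSpace := {Q | dQI P Q < ENNReal.ofReal r}

end GromovSpace

end

/-
Let `N(ε, T)` be the maximal number of points of the ball of radius `T` about the base point whose
mutual distances exceed `ε`. It is finite by properness and lower semicontinuous in the pointed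
space. A space at quasi-isometric distance less than `r` from `P` has its numbers `N(ε, T)` bounded
by those of `P`, once `ε` and `T` are distorted by an affine function depending only on `r`. Hence
the ball of radius `r` about `P` lies in a set `{Q | ∀ T, N(ε, T)(Q) ≤ b(T)}` with `b` finite, which
is closed by semicontinuity. Its interior is empty: attaching many points far from the base point
changes a space arbitrarily little in the topology, but makes `N(ε, T)` as large as one likes
for some fixed `T`.
-/

section PackingNumber

open Metric Topology

section PseudoEMetric

variable {X Y : Type*} [PseudoEMetricSpace X] [PseudoEMetricSpace Y] {s : Set X} {ε : ℝ≥0}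

theorem packingNumber_le_of_mapsTo {f : X → Y} {t : Set Y} {δ : ℝ≥0} (hst : Set.MapsTo f s t)
    (hf : ∀ x ∈ s, ∀ y ∈ s, ε < edist x y → δ < edist (f x) (f y)) :
    packingNumber ε s ≤ packingNumber δ t := by
  refine iSup_le fun C => iSup₂_le fun hCs hC => ?_
  have hsep {x y : X} (hx : x ∈ C) (hy : y ∈ C) (hxy : x ≠ y) : δ < edist (f x) (f y) :=
    hf x (hCs hx) y (hCs hy) (hC hx hy hxy)
  have hinj : Set.InjOn f C := fun x hx y hy hfxy => by
    by_contra hxy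
    simpa [hfxy] using hsep hx hy hxy
  rw [← hinj.encard_image]
  exact IsSeparated.encard_le_packingNumber (hst.mono_left hCs).image_subset
    (hinj.pairwise_image.2 fun _ hx _ hy hxy => hsep hx hy hxy)

theorem enatCard_le_packingNumber {ι : Type*} {p : ι → X} (hp : ∀ i, p i ∈ s)
    (hsep : Pairwise fun i j => ε < edist (p i) (p j)) : ENat.card ι ≤ packingNumber ε s := by
  have hinj : Function.Injective p := fun i j hij => by
    by_contra hne
    simpa [hij] using hsep hne
  rw [← Set.encard_univ, ← hinj.encard_image, Set.image_univ]
  refine IsSeparated.encard_le_packingNumber (Set.range_subset_iff.2 hp) ?_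
  rintro _ ⟨i, rfl⟩ _ ⟨j, rfl⟩ hij
  exact hsep fun h => hij (congrArg p h)

theorem packingNumber_ne_top_of_totallyBounded (hε : ε ≠ 0) (hs : TotallyBounded s) :
    packingNumber ε s ≠ ⊤ := by
  obtain ⟨C, -, hCfin, hC⟩ := exists_finite_isCover_of_totallyBounded (half_pos hε.bot_lt).ne' hs
  rw [← mul_div_cancel₀ ε two_ne_zero]
  exact ne_top_of_le_ne_top (Set.encard_ne_top_iff.2 hCfin)
    ((packingNumber_two_mul_le_externalCoveringNumber _ _).trans
      hC.externalCoveringNumber_le_encard)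

theorem exists_finite_isSeparated_of_lt_packingNumber {c : ℕ∞} (h : c < packingNumber ε s) :
    ∃ C ⊆ s, C.Finite ∧ IsSeparated ε C ∧ c < C.encard := by
  simp only [packingNumber, lt_iSup_iff] at h
  obtain ⟨C, hCs, hC, hc⟩ := h
  obtain ⟨C', hC'C, hC'⟩ := Set.exists_subset_encard_eq (Order.add_one_le_of_lt hc)
  have hcC' : c < C'.encard := hC' ▸ ENat.lt_add_one_iff hc.ne_top |>.2 le_rfl
  refine ⟨C', hC'C.trans hCs, ?_, hC.subset hC'C, hcC'⟩
  rw [← Set.encard_ne_top_iff, hC']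
  exact WithTop.add_ne_top.2 ⟨hc.ne_top, ENat.one_ne_top⟩

end PseudoEMetric

section Ball

variable {X Y Z : Type*} [PseudoMetricSpace X] [PseudoMetricSpace Y] [PseudoMetricSpace Z]
  {x : X} {y : Y} {T : ℝ} {r : ℝ≥0}

theorem exists_pos_lt_packingNumber_ball {ε : ℝ≥0} {c : ℕ∞}
    (h : c < packingNumber ε (ball x T)) :
    ∃ r : ℝ≥0, 0 < r ∧ c < packingNumber (ε + 2 * r) (ball x (T - 2 * r)) := by
  obtain ⟨C, hCT, hCfin, hC, hcard⟩ := exists_finite_isSeparated_of_lt_packingNumber h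
  have hball : ∀ᶠ r : ℝ≥0 in 𝓝 0, ∀ u ∈ C, dist u x < T - 2 * r := by
    refine hCfin.eventually_all.2 fun u hu =>
      ContinuousAt.eventually_lt (by fun_prop) (by fun_prop) ?_
    simpa using hCT hu
  have hsep : ∀ᶠ r : ℝ≥0 in 𝓝 0, ∀ u ∈ C, ∀ v ∈ C, u ≠ v → ε + 2 * r < nndist u v := by
    refine hCfin.eventually_all.2 fun u hu => hCfin.eventually_all.2 fun v hv =>
      Filter.eventually_imp_distrib_left.2 fun huv =>
        ContinuousAt.eventually_lt (by fun_prop) (by fun_prop) ?_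
    have hlt : (ε : ℝ≥0∞) < edist u v := hC hu hv huv
    rw [edist_nndist, ENNReal.coe_lt_coe] at hlt
    simpa using hlt
  obtain ⟨r, ⟨hrT, hrε⟩, hr⟩ := (((hball.and hsep).filter_mono nhdsWithin_le_nhds).and
    (self_mem_nhdsWithin (a := (0 : ℝ≥0)) (s := Set.Ioi 0))).exists
  refine ⟨r, hr, hcard.trans_le (IsSeparated.encard_le_packingNumber hrT ?_)⟩
  intro u hu v hv huv
  rw [edist_nndist]
  exact ENNReal.coe_lt_coe.2 (hrε u hu v hv huv)

theorem packingNumber_ball_le_of_isometry {i : X → Z} {j : Y → Z} (hi : Isometry i)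
    (hj : Isometry j) (hxy : dist (i x) (j y) ≤ r)
    (h : ∀ u ∈ ball x T, ∃ v, dist (i u) (j v) ≤ r) (ε : ℝ≥0) :
    packingNumber (ε + 2 * r) (ball x T) ≤ packingNumber ε (ball y (T + 2 * r)) := by
  have : Nonempty Y := ⟨y⟩
  choose! f hf using h
  refine packingNumber_le_of_mapsTo (f := f) (fun u hu => ?_) fun u hu v hv huv => ?_
  · have htri := dist_triangle4 (j (f u)) (i u) (i x) (j y)
    rw [dist_comm (j (f u)) (i u), hi.dist_eq, hj.dist_eq] at htri
    rw [mem_ball] at hu ⊢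
    linarith [hf u hu]
  · rw [edist_nndist, ENNReal.coe_lt_coe, ← NNReal.coe_lt_coe] at huv ⊢
    have htri := dist_triangle4_right (i u) (i v) (j (f u)) (j (f v))
    rw [hi.dist_eq, hj.dist_eq] at htri
    push_cast at huv ⊢
    linarith [hf u hu, hf v hv]

theorem packingNumber_ball_le_of_bilipschitz {f : X → Y} {K : ℝ≥0} (hK : K ≠ 0)
    (hf : LipschitzWith K f) (hf' : AntilipschitzWith K f) (x : X) (T : ℝ) (ε : ℝ≥0) :
    packingNumber (K * ε) (ball x T) ≤ packingNumber ε (ball (f x) (K * T)) :=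
  packingNumber_le_of_mapsTo (hf.mapsTo_ball hK x T) fun u _ v _ huv =>
    lt_of_mul_lt_mul_left' ((ENNReal.coe_mul K ε ▸ huv).trans_le (hf' u v))

end Ball

end PackingNumber

namespace PointedProperSpace

open Metric

theorem packingNumber_ball_ne_top (A : PointedProperSpace) {ε : ℝ≥0} (hε : ε ≠ 0) (T : ℝ) :
    packingNumber ε (ball A.pt T) ≠ ⊤ :=
  packingNumber_ne_top_of_totallyBounded hε
    ((isCompact_closedBall A.pt T).totallyBounded.subset ball_subset_closedBall)

theorem packingNumber_ball_le_of_equiv {A B : PointedProperSpace} (h : A ≈ B) (ε : ℝ≥0) (T : ℝ) :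
    packingNumber ε (ball A.pt T) ≤ packingNumber ε (ball B.pt T) := by
  obtain ⟨e, he⟩ := h
  simpa [he] using packingNumber_ball_le_of_bilipschitz one_ne_zero e.isometry.lipschitz
    e.isometry.antilipschitz A.pt T ε

theorem Close.exists_isometry {R r : ℝ} {A B : PointedProperSpace} (h : Close R r A B) :
    ∃ (Z : Type) (_ : MetricSpace Z) (i : A.carrier → Z) (j : B.carrier → Z),
      Isometry i ∧ Isometry j ∧ dist (i A.pt) (j B.pt) < r ∧
        (∀ u ∈ ball A.pt R, ∃ v, dist (i u) (j v) < r) ∧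
          ∀ v ∈ ball B.pt R, ∃ u, dist (j v) (i u) < r := by
  obtain ⟨d, hd, hlt⟩ := h
  obtain ⟨hpt, hH⟩ := max_lt_iff.1 hlt
  obtain ⟨hA, hB⟩ := max_lt_iff.1 hH
  have hinl : Isometry (Sum.inl : A.carrier → A.carrier ⊕ B.carrier) := Isometry.of_dist_eq hd.1
  have hinr : Isometry (Sum.inr : B.carrier → A.carrier ⊕ B.carrier) := Isometry.of_dist_eq hd.2
  refine ⟨_, d, Sum.inl, Sum.inr, hinl, hinr, edist_lt_ofReal.1 hpt, fun u hu => ?_, fun v hv => ?_⟩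
  · obtain ⟨_, ⟨v, rfl⟩, hv⟩ := infEDist_lt_iff.1 <|
      (le_iSup₂ (f := fun z _ => infEDist z _) (Sum.inl u)
        ⟨⟨u, rfl⟩, (hd.1 _ _).trans_lt hu⟩).trans_lt hA
    exact ⟨v, edist_lt_ofReal.1 hv⟩
  · obtain ⟨_, ⟨u, rfl⟩, hu⟩ := infEDist_lt_iff.1 <|
      (le_iSup₂ (f := fun z _ => infEDist z _) (Sum.inr v)
        ⟨⟨v, rfl⟩, (hd.2 _ _).trans_lt hv⟩).trans_lt hB
    exact ⟨u, edist_lt_ofReal.1 hu⟩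

theorem Close.packingNumber_ball_le {T : ℝ} {r : ℝ≥0} {A B : PointedProperSpace}
    (h : Close T r A B) (ε : ℝ≥0) :
    packingNumber (ε + 2 * r) (ball A.pt T) ≤ packingNumber ε (ball B.pt (T + 2 * r)) ∧
      packingNumber (ε + 2 * r) (ball B.pt T) ≤ packingNumber ε (ball A.pt (T + 2 * r)) := by
  obtain ⟨Z, _, i, j, hi, hj, hpt, hA, hB⟩ := h.exists_isometry
  exact ⟨packingNumber_ball_le_of_isometry hi hj hpt.le
      (fun u hu => (hA u hu).imp fun _ => le_of_lt) ε,
    packingNumber_ball_le_of_isometry hj hi ((dist_comm _ _).trans_le hpt.le)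
      (fun v hv => (hB v hv).imp fun _ => le_of_lt) ε⟩

theorem close_of_ghDist_lt {r : ℝ} {A B : PointedProperSpace}
    (h : ghDist A B < ENNReal.ofReal r) (R : ℝ) : Close R r A B := by
  simp only [ghDist, iInf_lt_iff] at h
  obtain ⟨d, hd, hlt⟩ := h
  refine ⟨d, hd, (max_le_max le_rfl (max_le ?_ ?_)).trans_lt hlt⟩
  · exact iSup₂_le fun u hu => infEDist_le_hausdorffEDist_of_mem hu.1
  · rw [hausdorffEDist_comm]
    exact iSup₂_le fun v hv => infEDist_le_hausdorffEDist_of_mem hv.1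

theorem exists_bilipschitz_of_lipDist_lt {a : ℝ≥0} {A B : PointedProperSpace}
    (h : lipDist A B < a) : ∃ φ : A.carrier ≃ B.carrier, φ A.pt = B.pt ∧
      LipschitzWith (Real.exp a).toNNReal φ ∧ LipschitzWith (Real.exp a).toNNReal φ.symm := by
  simp only [lipDist, iInf_lt_iff] at h
  obtain ⟨r, ⟨φ, hφ, hr⟩, hra⟩ := h
  have hexp : Real.exp r ≤ Real.exp a := Real.exp_le_exp.2 (ENNReal.coe_lt_coe.1 hra).le
  refine ⟨φ, hφ, .of_dist_le_mul fun u v => ?_, .of_dist_le_mul fun u v => ?_⟩ <;>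
    rw [Real.coe_toNNReal _ (Real.exp_pos _).le]
  · exact (hr u v).2.trans (by gcongr)
  · have hinv := (hr (φ.symm u) (φ.symm v)).1
    rw [φ.apply_symm_apply, φ.apply_symm_apply, Real.exp_neg,
      inv_mul_le_iff₀ (Real.exp_pos _)] at hinv
    exact hinv.trans (by gcongr)

theorem LipEquivalent.lipDist_lt_top {A B : PointedProperSpace} (h : LipEquivalent A B) :
    lipDist A B < ∞ := by
  obtain ⟨φ, hφ, K, K', hK, hK'⟩ := h
  have hexp {L : ℝ≥0} (hL : L ≤ max K K') : (L : ℝ) ≤ Real.exp (max K K' : ℝ≥0) :=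
    (NNReal.coe_le_coe.2 hL).trans ((lt_add_one _).le.trans (Real.add_one_le_exp _))
  refine (iInf₂_le (max K K') ⟨φ, hφ, fun u v => ⟨?_, ?_⟩⟩).trans_lt ENNReal.coe_lt_top
  · rw [Real.exp_neg, inv_mul_le_iff₀ (Real.exp_pos _)]
    calc dist u v = dist (φ.symm (φ u)) (φ.symm (φ v)) := by simp only [φ.symm_apply_apply]
      _ ≤ K' * dist (φ u) (φ v) := hK'.dist_le_mul _ _
      _ ≤ Real.exp (max K K' : ℝ≥0) * dist (φ u) (φ v) := by gcongr; exact hexp (le_max_right _ _)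
  · exact (hK.dist_le_mul u v).trans (by gcongr; exact hexp (le_max_left _ _))

theorem close_of_isometry {X : Type} [MetricSpace X] {A B : PointedProperSpace}
    {i : A.carrier → X} {j : B.carrier → X} (hi : Isometry i) (hj : Isometry j)
    (hpt : i A.pt = j B.pt) {R r : ℝ} (hA : i '' ball A.pt R ⊆ Set.range j)
    (hB : j '' ball B.pt R ⊆ Set.range i) (hr : 0 < r) : Close R r A B := by
  -- The two images may meet, so they are placed on parallel slices of `X × ℝ`.
  let f : A.carrier ⊕ B.carrier → X × ℝ := Sum.elim (fun u => (i u, 0)) fun v => (j v, r / 2)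
  have hf : Function.Injective f :=
    Function.Injective.sumElim (fun u u' h => hi.injective (congrArg Prod.fst h))
      (fun v v' h => hj.injective (congrArg Prod.fst h))
      fun u v h => (half_pos hr).ne (congrArg Prod.snd h)
  let d : MetricSpace (A.carrier ⊕ B.carrier) := MetricSpace.induced f hf inferInstance
  have hlink {u : A.carrier} {v : B.carrier} (huv : i u = j v) :
      edist (Sum.inl u : A.carrier ⊕ B.carrier) (Sum.inr v) ≤ ENNReal.ofReal (r / 2) := by
    change edist (i u, (0 : ℝ)) (j v, r / 2) ≤ _
    rw [edist_le_ofReal (half_pos hr).le, Prod.dist_eq, huv, dist_self, dist_zero_left,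
      Real.norm_of_nonneg (half_pos hr).le, max_eq_right (half_pos hr).le]
  have hinl (u u' : A.carrier) : d.dist (Sum.inl u) (Sum.inl u') = dist u u' := by
    change dist (i u, (0 : ℝ)) (i u', 0) = _
    rw [dist_prod_same_right, hi.dist_eq]
  have hinr (v v' : B.carrier) : d.dist (Sum.inr v) (Sum.inr v') = dist v v' := by
    change dist (j v, r / 2) (j v', r / 2) = _
    rw [dist_prod_same_right, hj.dist_eq]
  refine ⟨d, ⟨hinl, hinr⟩, lt_of_le_of_lt
    (max_le (hlink hpt) (max_le (iSup₂_le ?_) (iSup₂_le ?_)))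
    ((ENNReal.ofReal_lt_ofReal_iff hr).2 (half_lt_self hr))⟩
  · rintro _ ⟨⟨u, rfl⟩, hu⟩
    obtain ⟨v, hv⟩ := hA ⟨u, (hinl _ _).symm.trans_lt hu, rfl⟩
    exact (infEDist_le_edist_of_mem (Set.mem_range_self v)).trans (hlink hv.symm)
  · rintro _ ⟨⟨v, rfl⟩, hv⟩
    obtain ⟨u, hu⟩ := hB ⟨v, (hinr _ _).symm.trans_lt hv, rfl⟩
    exact (infEDist_le_edist_of_mem (Set.mem_range_self u)).trans
      ((edist_comm _ _).trans_le (hlink hu))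

/-- The space `A` with `k` points attached at distance `D` from the base point and from each other,
encoded as the subset of `A × ℝᵏ`, with the maximum metric, that consists of `A × {0}` and the
points `(A.pt, D eᵢ)`. -/
def attachPoints (A : PointedProperSpace) (k : ℕ) (D : ℝ) : PointedProperSpace where
  carrier := ({z | z.2 = 0} ∪ Set.range fun i => (A.pt, Pi.single i D) :
    Set (A.carrier × (Fin k → ℝ)))
  proper := .of_isClosed <|
    (isClosed_eq continuous_snd continuous_const).union (Set.finite_range _).isClosed
  pt := ⟨(A.pt, 0), Or.inl rfl⟩

theorem close_attachPoints (A : PointedProperSpace) (k : ℕ) {R r D : ℝ} (hR : R ≤ D)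
    (hr : 0 < r) : Close R r A (attachPoints A k D) := by
  refine close_of_isometry (X := A.carrier × (Fin k → ℝ)) (i := fun u => (u, 0))
    (j := Subtype.val) (.of_dist_eq fun u v => dist_prod_same_right) isometry_subtype_coe rfl
    ?_ ?_ hr
  · rintro _ ⟨u, -, rfl⟩
    exact ⟨⟨(u, 0), Or.inl rfl⟩, rfl⟩
  · rintro _ ⟨⟨⟨u, w⟩, hw | ⟨i, hi⟩⟩, hball, rfl⟩
    · exact ⟨u, Prod.ext rfl hw.symm⟩
    · have hdist : dist (u, w) (A.pt, 0) < R := hball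
      rw [← hi, dist_prod_same_left, dist_zero_right, Pi.norm_single] at hdist
      exact absurd (hR.trans (Real.le_norm_self D)) hdist.not_ge

theorem le_packingNumber_attachPoints (A : PointedProperSpace) (k : ℕ) {ε D : ℝ≥0} {T : ℝ}
    (hε : ε < D) (hT : D < T) : k ≤ packingNumber ε (ball (attachPoints A k D).pt T) := by
  let p (i : Fin k) : (attachPoints A k D).carrier := ⟨(A.pt, Pi.single i D), Or.inr ⟨i, rfl⟩⟩
  have hp (i : Fin k) : p i ∈ ball (attachPoints A k D).pt T := by
    change dist (A.pt, (Pi.single i (D : ℝ) : Fin k → ℝ)) (A.pt, 0) < T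
    rwa [dist_prod_same_left, dist_zero_right, Pi.norm_single, NNReal.norm_eq]
  have hsep : Pairwise fun i j => ε < edist (p i) (p j) := fun i j hij => by
    change ε < edist (p i) (p j)
    rw [edist_nndist, ENNReal.coe_lt_coe, ← NNReal.coe_lt_coe, coe_nndist]
    calc (ε : ℝ) < D := hε
      _ = dist ((Pi.single i (D : ℝ) : Fin k → ℝ) i) ((Pi.single j (D : ℝ) : Fin k → ℝ) i) := by
        simp [Pi.single_eq_of_ne hij]
      _ ≤ dist (Pi.single i (D : ℝ) : Fin k → ℝ) (Pi.single j (D : ℝ)) := dist_le_pi_dist _ _ i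
      _ ≤ dist (p i) (p j) := le_max_right _ _
  simpa using enatCard_le_packingNumber hp hsep

end PointedProperSpace

namespace GromovSpace

open PointedProperSpace Metric

/-- The maximal number of points of the open ball of radius `T` about the base point whose mutual
distances are larger than `ε`. -/
noncomputable def packing (ε : ℝ≥0) (T : ℝ) : GromovSpace → ℕ∞ :=
  Quotient.lift (fun A : PointedProperSpace => packingNumber ε (ball A.pt T)) fun _ _ h =>
    le_antisymm (packingNumber_ball_le_of_equiv h ε T)
      (packingNumber_ball_le_of_equiv (Setoid.symm h) ε T)

theorem packing_mono {ε ε' : ℝ≥0} {T T' : ℝ} (hε : ε' ≤ ε) (hT : T ≤ T') (P : GromovSpace) :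
    packing ε T P ≤ packing ε' T' P := by
  induction P using Quotient.inductionOn
  exact packingNumber_le_of_mapsTo (f := id) (ball_subset_ball hT) fun _ _ _ _ huv =>
    (ENNReal.coe_le_coe.2 hε).trans_lt huv

theorem packing_ne_top {ε : ℝ≥0} (hε : ε ≠ 0) (T : ℝ) (P : GromovSpace) : packing ε T P ≠ ⊤ := by
  induction P using Quotient.inductionOn with
  | _ A => exact A.packingNumber_ball_ne_top hε T

theorem Entourage.packing_le {T : ℝ} {r : ℝ≥0} {P Q : GromovSpace} (h : Entourage T r P Q)
    (ε : ℝ≥0) : packing (ε + 2 * r) T P ≤ packing ε (T + 2 * r) Q ∧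
      packing (ε + 2 * r) T Q ≤ packing ε (T + 2 * r) P := by
  induction P using Quotient.inductionOn
  induction Q using Quotient.inductionOn
  exact Close.packingNumber_ball_le h ε

theorem exists_pos_lt_packing {ε : ℝ≥0} {T : ℝ} {c : ℕ∞} {P : GromovSpace}
    (h : c < packing ε T P) : ∃ r : ℝ≥0, 0 < r ∧ c < packing (ε + 2 * r) (T - 2 * r) P := by
  induction P using Quotient.inductionOn
  exact exists_pos_lt_packingNumber_ball h

theorem isOpen_iff {O : Set GromovSpace} :
    IsOpen O ↔ ∀ P ∈ O, ∃ R > 0, ∃ r > 0, ∀ Q, Entourage R r P Q → Q ∈ O :=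
  Iff.rfl

theorem lowerSemicontinuous_packing (ε : ℝ≥0) (T : ℝ) : LowerSemicontinuous (packing ε T) := by
  refine lowerSemicontinuous_iff_isOpen_preimage.2 fun c => isOpen_iff.2 fun P hP => ?_
  obtain ⟨r, hr, hc⟩ := exists_pos_lt_packing hP
  refine ⟨max (T - 2 * r) 1, by positivity, r, hr, fun Q hPQ => ?_⟩
  have hle := ((hPQ.mono (le_max_left _ _) le_rfl).packing_le ε).1
  rw [sub_add_cancel] at hle
  exact hc.trans_le hle

theorem exists_entourage_lt_packing (P : GromovSpace) (R : ℝ) {r : ℝ} (hr : 0 < r) (ε : ℝ≥0) :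
    ∃ T : ℝ≥0, ∀ n : ℕ, ∃ Q, Entourage R r P Q ∧ n < packing ε T Q := by
  induction P using Quotient.inductionOn with
  | _ A =>
    let D : ℝ≥0 := max R.toNNReal (ε + 1)
    have hR : R ≤ D := (Real.le_coe_toNNReal R).trans (NNReal.coe_le_coe.2 (le_max_left _ _))
    have hε : ε < D := (lt_add_one ε).trans_le (le_max_right _ _)
    refine ⟨D + 1, fun n => ⟨⟦A.attachPoints (n + 1) D⟧, A.close_attachPoints (n + 1) hR hr, ?_⟩⟩
    exact (Nat.cast_lt.2 n.lt_succ_self).trans_le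
      (A.le_packingNumber_attachPoints (n + 1) hε (NNReal.coe_lt_coe.2 (lt_add_one D)))

theorem isNowhereDense_setOf_packing_le (ε : ℝ≥0) {N : ℝ≥0 → ℕ∞} (hN : ∀ T, N T ≠ ⊤) :
    IsNowhereDense {Q : GromovSpace | ∀ T : ℝ≥0, packing ε T Q ≤ N T} := by
  have hclosed : IsClosed {Q : GromovSpace | ∀ T : ℝ≥0, packing ε T Q ≤ N T} := by
    simp only [Set.ofPred_forall]
    exact isClosed_iInter fun T => (lowerSemicontinuous_packing ε T).isClosed_preimage (N T)
  rw [hclosed.isNowhereDense_iff, Set.eq_empty_iff_forall_notMem]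
  intro P hP
  obtain ⟨R, -, r, hr, hsub⟩ := isOpen_iff.1 isOpen_interior P hP
  obtain ⟨T, hT⟩ := exists_entourage_lt_packing P R hr ε
  obtain ⟨n, hn⟩ := ENat.ne_top_iff_exists.1 (hN T)
  obtain ⟨Q, hPQ, hQ⟩ := hT n
  exact (hn ▸ hQ).not_ge (interior_subset (hsub Q hPQ) T)

/-- A common bound for the distortion of scales and radii by a Gromov-Hausdorff perturbation of size
`a`, which adds `2a`, and by an `eᵃ`-bi-Lipschitz map; the combination makes `gauge_gauge_le`
hold. -/
noncomputable def gauge (a t : ℝ≥0) : ℝ≥0 := (Real.exp a).toNNReal * (t + 2 * a)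

theorem one_le_toNNReal_exp (a : ℝ≥0) : 1 ≤ (Real.exp a).toNNReal :=
  Real.one_le_toNNReal.2 (Real.one_le_exp a.coe_nonneg)

theorem gauge_zero (t : ℝ≥0) : gauge 0 t = t := by simp [gauge]

theorem gauge_mono {a b s t : ℝ≥0} (hab : a ≤ b) (hst : s ≤ t) : gauge a s ≤ gauge b t := by
  unfold gauge
  gcongr

theorem add_le_gauge (a t : ℝ≥0) : t + 2 * a ≤ gauge a t :=
  le_mul_of_one_le_left' (one_le_toNNReal_exp a)

theorem exp_mul_le_gauge (a t : ℝ≥0) : (Real.exp a).toNNReal * t ≤ gauge a t :=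
  mul_le_mul_right (le_add_right le_rfl) _

theorem gauge_gauge_le (a b t : ℝ≥0) : gauge a (gauge b t) ≤ gauge (a + b) t := by
  have hexp : (Real.exp ↑(a + b)).toNNReal = (Real.exp a).toNNReal * (Real.exp b).toNNReal := by
    rw [NNReal.coe_add, Real.exp_add, Real.toNNReal_mul (Real.exp_pos _).le]
  calc gauge a (gauge b t)
      ≤ (Real.exp a).toNNReal *
          ((Real.exp b).toNNReal * (t + 2 * b) + (Real.exp b).toNNReal * (2 * a)) :=
        mul_le_mul_right
          (add_le_add_right (le_mul_of_one_le_left' (one_le_toNNReal_exp b)) _) _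
    _ = gauge (a + b) t := by rw [gauge, hexp]; ring

/-- The packing numbers of `P` are at most those of `Q`, up to a distortion of scales and radii by
`gauge a`. -/
def PackingDominated (a : ℝ≥0) (P Q : GromovSpace) : Prop :=
  ∀ ε T : ℝ≥0, packing (gauge a ε) T P ≤ packing ε (gauge a T) Q

namespace PackingDominated

variable {a b : ℝ≥0} {P Q S : GromovSpace}

theorem zero_self (P : GromovSpace) : PackingDominated 0 P P := fun ε T => by
  simp only [gauge_zero, le_refl]

theorem mono (hab : a ≤ b) (h : PackingDominated a P Q) : PackingDominated b P Q := fun ε T =>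
  calc packing (gauge b ε) T P
      ≤ packing (gauge a ε) T P := packing_mono (gauge_mono hab le_rfl) le_rfl P
    _ ≤ packing ε (gauge a T) Q := h ε T
    _ ≤ packing ε (gauge b T) Q := packing_mono le_rfl (gauge_mono hab le_rfl) Q

theorem trans (h : PackingDominated a P Q) (h' : PackingDominated b Q S) :
    PackingDominated (a + b) P S := fun ε T =>
  calc packing (gauge (a + b) ε) T P
      ≤ packing (gauge a (gauge b ε)) T P := packing_mono (gauge_gauge_le a b ε) le_rfl P
    _ ≤ packing (gauge b ε) (gauge a T) Q := h _ T
    _ ≤ packing ε (gauge b (gauge a T)) S := h' ε _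
    _ ≤ packing ε (gauge (a + b) T) S :=
      packing_mono le_rfl (add_comm a b ▸ gauge_gauge_le b a T) S

end PackingDominated

theorem packingDominated_of_forall_entourage {a : ℝ≥0} {P Q : GromovSpace}
    (h : ∀ R : ℝ, Entourage R a P Q) : PackingDominated a P Q ∧ PackingDominated a Q P := by
  have hstretch {P Q : GromovSpace} {ε T : ℝ≥0}
      (h : packing (ε + 2 * a) T P ≤ packing ε (T + 2 * a) Q) :
      packing (gauge a ε) T P ≤ packing ε (gauge a T) Q :=
    ((packing_mono (add_le_gauge a ε) le_rfl P).trans h).trans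
      (packing_mono le_rfl (mod_cast add_le_gauge a T) Q)
  exact ⟨fun ε T => hstretch ((h T).packing_le ε).1, fun ε T => hstretch ((h T).packing_le ε).2⟩

theorem packingDominated_of_dGH_lt {a : ℝ≥0} {P Q : GromovSpace} (h : dGH P Q < a) :
    PackingDominated a P Q ∧ PackingDominated a Q P := by
  induction P using Quotient.inductionOn
  induction Q using Quotient.inductionOn
  exact packingDominated_of_forall_entourage
    (close_of_ghDist_lt (by rwa [ENNReal.ofReal_coe_nnreal]))

theorem packingDominated_of_bilipschitz {a : ℝ≥0} {A B : PointedProperSpace}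
    {φ : A.carrier ≃ B.carrier} (hpt : φ A.pt = B.pt) (hφ : LipschitzWith (Real.exp a).toNNReal φ)
    (hφ' : LipschitzWith (Real.exp a).toNNReal φ.symm) :
    PackingDominated a (⟦A⟧ : GromovSpace) ⟦B⟧ := fun ε T => by
  have hexp : (Real.exp a).toNNReal ≠ 0 := (Real.toNNReal_pos.2 (Real.exp_pos _)).ne'
  calc packing (gauge a ε) T ⟦A⟧
      ≤ packing ((Real.exp a).toNNReal * ε) T ⟦A⟧ := packing_mono (exp_mul_le_gauge a ε) le_rfl _
    _ ≤ packing ε ((Real.exp a).toNNReal * T) ⟦B⟧ :=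
      (packingNumber_ball_le_of_bilipschitz hexp hφ (hφ'.to_rightInverse φ.left_inv)
        A.pt T ε).trans_eq (by rw [hpt]; rfl)
    _ ≤ packing ε (gauge a T) ⟦B⟧ := packing_mono le_rfl (mod_cast exp_mul_le_gauge a T) _

theorem packingDominated_of_dLip_lt {a : ℝ≥0} {P Q : GromovSpace} (h : dLip P Q < a) :
    PackingDominated a P Q ∧ PackingDominated a Q P := by
  induction P using Quotient.inductionOn with | _ A
  induction Q using Quotient.inductionOn with | _ B
  obtain ⟨φ, hpt, hφ, hφ'⟩ := exists_bilipschitz_of_lipDist_lt (A := A) (B := B) h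
  exact ⟨packingDominated_of_bilipschitz hpt hφ hφ',
    packingDominated_of_bilipschitz (φ.symm_apply_eq.2 hpt.symm) hφ' hφ⟩

/-- The infimum of the `a` for which the packing numbers of `P` and `Q` dominate each other up to a
distortion by `gauge a`; it is a lower bound for `dQI`. -/
noncomputable def packingDist (P Q : GromovSpace) : ℝ≥0∞ :=
  ⨅ (a : ℝ≥0) (_ : PackingDominated a P Q ∧ PackingDominated a Q P), (a : ℝ≥0∞)

theorem packingDist_self (P : GromovSpace) : packingDist P P = 0 :=
  nonpos_iff_eq_zero.1 (iInf₂_le 0 ⟨.zero_self P, .zero_self P⟩)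

theorem packingDist_comm (P Q : GromovSpace) : packingDist P Q = packingDist Q P := by
  simp only [packingDist, and_comm]

theorem packingDist_triangle (P Q S : GromovSpace) :
    packingDist P S ≤ packingDist P Q + packingDist Q S :=
  ENNReal.le_iInf₂_add_iInf₂ fun a ha b hb => (iInf₂_le (a + b) ⟨ha.1.trans hb.1,
    add_comm b a ▸ hb.2.trans ha.2⟩).trans_eq (ENNReal.coe_add a b)

theorem packingDominated_of_packingDist_lt {r : ℝ≥0} {P Q : GromovSpace}
    (h : packingDist P Q < r) : PackingDominated r Q P := by
  simp only [packingDist, iInf_lt_iff] at h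
  obtain ⟨a, ha, har⟩ := h
  exact ha.2.mono (ENNReal.coe_lt_coe.1 har).le

theorem packingDist_le_of_forall_lt {d : ℝ≥0∞} {P Q : GromovSpace}
    (h : ∀ a : ℝ≥0, d < a → PackingDominated a P Q ∧ PackingDominated a Q P) :
    packingDist P Q ≤ d :=
  le_of_not_gt fun hlt =>
    have ⟨a, hda, ha⟩ := ENNReal.lt_iff_exists_nnreal_btwn.1 hlt
    ha.not_ge (iInf₂_le a (h a hda))

theorem packingDist_le_dGH (P Q : GromovSpace) : packingDist P Q ≤ dGH P Q :=
  packingDist_le_of_forall_lt fun _ => packingDominated_of_dGH_lt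

theorem packingDist_le_dLip (P Q : GromovSpace) : packingDist P Q ≤ dLip P Q :=
  packingDist_le_of_forall_lt fun _ => packingDominated_of_dLip_lt

theorem le_dQI {δ : GromovSpace → GromovSpace → ℝ≥0∞} (hself : ∀ P, δ P P = 0)
    (htri : ∀ P Q S, δ P S ≤ δ P Q + δ Q S) (hGH : ∀ P Q, δ P Q ≤ dGH P Q)
    (hLip : ∀ P Q, δ P Q ≤ dLip P Q) (P Q : GromovSpace) : δ P Q ≤ dQI P Q := by
  have hchain (c : ℕ → GromovSpace) (k : ℕ) : δ (c 0) (c (2 * k)) ≤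
      ∑ i ∈ Finset.range k,
        (dGH (c (2 * i)) (c (2 * i + 1)) + dLip (c (2 * i + 1)) (c (2 * i + 2))) := by
    induction k with
    | zero => exact (hself _).le
    | succ k ih =>
      rw [Finset.sum_range_succ]
      exact (htri _ (c (2 * k)) _).trans <| add_le_add ih <|
        (htri _ (c (2 * k + 1)) _).trans <| add_le_add (hGH _ _) (hLip _ _)
  refine le_iInf₂ fun k _ => le_iInf₂ fun c hP => le_iInf fun hQ => ?_
  rw [← hP, ← hQ]
  exact hchain c k

theorem packingDist_le_dQI (P Q : GromovSpace) : packingDist P Q ≤ dQI P Q :=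
  le_dQI packingDist_self packingDist_triangle packingDist_le_dGH packingDist_le_dLip P Q

theorem ELip.dLip_lt_top {P Q : GromovSpace} (h : ELip P Q) : dLip P Q < ∞ := by
  induction P using Quotient.inductionOn
  induction Q using Quotient.inductionOn
  exact LipEquivalent.lipDist_lt_top h

theorem packingDist_lt_top_of_eqi {P Q : GromovSpace} (h : EQI P Q) : packingDist P Q < ∞ := by
  change Relation.EqvGen _ P Q at h
  induction h with
  | rel P Q h =>
    exact h.elim (packingDist_le_dGH P Q).trans_lt fun hLip =>
      (packingDist_le_dLip P Q).trans_lt hLip.dLip_lt_top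
  | refl P => exact (packingDist_self P).trans_lt ENNReal.zero_lt_top
  | symm P Q _ ih => rwa [packingDist_comm]
  | trans P Q S _ _ ih ih' =>
    exact (packingDist_triangle P Q S).trans_lt (ENNReal.add_lt_top.2 ⟨ih, ih'⟩)

theorem isNowhereDense_setOf_packingDist_lt (P : GromovSpace) (r : ℝ≥0) :
    IsNowhereDense {Q | packingDist P Q < r} :=
  (isNowhereDense_setOf_packing_le (gauge r 1) fun T =>
    packing_ne_top one_ne_zero (gauge r T) P).mono fun _ hQ =>
      packingDominated_of_packingDist_lt hQ 1

end GromovSpace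

theorem propositionp :
    (∀ P : GromovSpace, IsMeagre {Q : GromovSpace | GromovSpace.EQI P Q}) ∧
      (∀ (P : GromovSpace) (r : ℝ), 0 < r → IsNowhereDense (GromovSpace.ballQI P r)) := by
  have hball (P : GromovSpace) (r : ℝ≥0) :=
    GromovSpace.isNowhereDense_setOf_packingDist_lt P r
  refine ⟨fun P => ?_, fun P r _ => (hball P r.toNNReal).mono fun Q hQ => ?_⟩
  · refine (isMeagre_iUnion fun n : ℕ => (hball P n).isMeagre).mono fun Q hQ => ?_
    obtain ⟨n, hn⟩ := ENNReal.exists_nat_gt (GromovSpace.packingDist_lt_top_of_eqi hQ).ne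
    exact Set.mem_iUnion.2 ⟨n, by simpa using hn⟩
  · exact (GromovSpace.packingDist_le_dQI P Q).trans_lt hQ
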